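/- Let $X$ be a complex Hilbert space and let $H : D(H)\to X$ and $A : D(A)\to X$ be densely defined linear operators on $X$ such that $H$ is self-adjoint, $A$ is closed, and $A$ is hermitean, i.e. $\langle A\psi,\varphi\rangle=\langle\psi,A\varphi\rangle$ for all $\psi,\varphi\in D(A)$. Let $T(t):=e^{-itH}$, $t\in\mathbb R$, be the strongly continuous one-parameter unitary group generated by $H$, and suppose that $T(t)$ maps $D(A)\cap D(H)$ into itself for every $t\in\mathbb R$. Then for every $\psi_0\in D(A)\cap D(H)$ and every bounded set $I\subset\mathbb R$, $$\sup_{t\in I}\|A\,T(t)\psi_0\|<\infty .$$ -/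

import Mathlib

namespace UnitaryEvolution

open Filter Topology Complex

variable {X : Type*} [NormedAddCommGroup X] [InnerProductSpace ℂ X]

/-- `T` is the strongly continuous one-parameter unitary group `T t = e^{-itH}` generated by `H`:
it is a strongly continuous group of unitary operators, and `x ∈ D(H)`, `H x = y` holds exactly
when `t ↦ T t x` is differentiable at `0` with derivative `-i y`. -/
structure IsUnitaryGroupOf [CompleteSpace X] (H : X →ₗ.[ℂ] X) (T : ℝ → X →L[ℂ] X) : Prop where
  zero : T 0 = 1
  add : ∀ s t : ℝ, T (s + t) = T s * T t
  unitary : ∀ t : ℝ, T t ∈ unitary (X →L[ℂ] X)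
  continuous : ∀ x : X, Continuous fun t : ℝ => T t x
  generator : ∀ x y : X, (x, y) ∈ H.graph ↔ HasDerivAt (fun t : ℝ => T t x) (-I • y) 0

variable [CompleteSpace X] {H : X →ₗ.[ℂ] X}

theorem graph_symm (hH : IsSelfAdjoint H) {p q : X × X} (hp : p ∈ H.graph) (hq : q ∈ H.graph) :
    inner ℂ p.2 q.1 = inner ℂ p.1 q.2 := by
  obtain ⟨x, hx, hx'⟩ := (LinearPMap.mem_graph_iff H).1 hp
  obtain ⟨y, hy, hy'⟩ := (LinearPMap.mem_graph_iff H).1 hq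
  have h : H.IsFormalAdjoint H := by
    have := LinearPMap.adjoint_isFormalAdjoint hH.dense_domain
    rwa [LinearPMap.isSelfAdjoint_def.1 hH] at this
  rw [← hx, ← hy, ← hx', ← hy']
  exact h x y

theorem graph_max (hH : IsSelfAdjoint H) {x y : X}
    (h : ∀ p ∈ H.graph, inner ℂ y p.1 = inner ℂ x p.2) : (x, y) ∈ H.graph := by
  rw [← LinearPMap.isSelfAdjoint_def.1 hH,
    LinearPMap.adjoint_graph_eq_graph_adjoint hH.dense_domain, Submodule.mem_adjoint_iff]
  intro a b hab
  have := congrArg (starRingEnd ℂ) (h _ hab)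
  simp only [inner_conj_symm] at this
  simp [this]

theorem graph_dense (hH : IsSelfAdjoint H) (y : X) {ε : ℝ} (hε : 0 < ε) :
    ∃ p ∈ H.graph, ‖y - p.1‖ < ε := by
  obtain ⟨z, hz, hz'⟩ := Metric.mem_closure_iff.1 (hH.dense_domain y) ε hε
  exact ⟨(z, H ⟨z, hz⟩), H.mem_graph ⟨z, hz⟩, by rwa [← dist_eq_norm]⟩

theorem norm_add_sq (hH : IsSelfAdjoint H) {p : X × X} (hp : p ∈ H.graph) (μ : ℝ) :
    ‖p.2 + (I * μ) • p.1‖ ^ 2 = ‖p.2‖ ^ 2 + μ ^ 2 * ‖p.1‖ ^ 2 := by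
  have h1 : (inner ℂ p.2 p.1).im = 0 := by
    have := graph_symm hH hp hp
    rw [← inner_conj_symm p.1 p.2] at this
    exact Complex.conj_eq_iff_im.1 this.symm
  rw [@_root_.norm_add_sq ℂ, inner_smul_right, norm_smul]
  simp [h1, mul_pow]

theorem exists_resolvent (hH : IsSelfAdjoint H) {μ : ℝ} (hμ : μ ≠ 0) :
    ∃ R : X →L[ℂ] X, (∀ v, (R v, v - (I * μ) • R v) ∈ H.graph) ∧
      (∀ p ∈ H.graph, R (p.2 + (I * μ) • p.1) = p.1) ∧ ∀ v, |μ| * ‖R v‖ ≤ ‖v‖ := by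
  have hcl : IsClosed (H.graph : Set (X × X)) := hH.isClosed
  have : CompleteSpace H.graph := hcl.completeSpace_coe
  let L : H.graph →L[ℂ] X := (ContinuousLinearMap.snd ℂ X X +
    (I * μ : ℂ) • ContinuousLinearMap.fst ℂ X X).comp H.graph.subtypeL
  have hL : ∀ p : H.graph, L p = (p : X × X).2 + (I * μ) • (p : X × X).1 := fun p => rfl
  have hμ' : 0 < |μ| := abs_pos.2 hμ
  have hb1 : ∀ p : H.graph, |μ| * ‖(p : X × X).1‖ ≤ ‖L p‖ := fun p => by
    have := norm_add_sq hH p.2 μ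
    rw [← hL] at this
    refine abs_le_of_sq_le_sq' ?_ (norm_nonneg _) |>.2
    rw [mul_pow, sq_abs, this]
    nlinarith [sq_nonneg ‖(p : X × X).2‖]
  have hb2 : ∀ p : H.graph, ‖(p : X × X).2‖ ≤ ‖L p‖ := fun p => by
    have := norm_add_sq hH p.2 μ
    rw [← hL] at this
    refine abs_le_of_sq_le_sq' ?_ (norm_nonneg _) |>.2
    rw [this]
    nlinarith [mul_nonneg (sq_nonneg μ) (sq_nonneg ‖(p : X × X).1‖)]
  have hanti : AntilipschitzWith (Real.toNNReal (max |μ|⁻¹ 1)) L := by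
    refine ContinuousLinearMap.antilipschitz_of_bound L fun p => ?_
    rw [Real.coe_toNNReal _ (by positivity)]
    have h3 : ‖p‖ = max ‖(p : X × X).1‖ ‖(p : X × X).2‖ := rfl
    rw [h3]
    refine max_le ?_ ?_
    · calc ‖(p : X × X).1‖ = |μ|⁻¹ * (|μ| * ‖(p : X × X).1‖) := by field_simp
        _ ≤ |μ|⁻¹ * ‖L p‖ := by gcongr; exact hb1 p
        _ ≤ _ := by gcongr; exact le_max_left _ _
    · calc ‖(p : X × X).2‖ ≤ 1 * ‖L p‖ := by rw [one_mul]; exact hb2 p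
        _ ≤ _ := by gcongr; exact le_max_right _ _
  have hker : L.ker = ⊥ := LinearMap.ker_eq_bot.2 hanti.injective
  have hclr : IsClosed (Set.range L) := hanti.isClosed_range L.uniformContinuous
  have hrange : L.range = ⊤ := by
    have : CompleteSpace L.range := IsClosed.completeSpace_coe (hs := hclr)
    rw [← Submodule.orthogonal_eq_bot_iff, Submodule.eq_bot_iff]
    intro w hw
    have hw' : ∀ p ∈ H.graph, inner ℂ w (p.2 + (I * μ) • p.1) = 0 := fun p hp =>
      Submodule.inner_left_of_mem_orthogonal (K := L.range) ⟨⟨p, hp⟩, rfl⟩ hw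
    have hm : (w, (I * μ) • w) ∈ H.graph := by
      refine graph_max hH fun p hp => ?_
      have := hw' p hp
      rw [inner_add_right, inner_smul_right] at this
      rw [inner_smul_left]
      simp only [map_mul, conj_I, conj_ofReal]
      linear_combination -this
    have h5 := norm_add_sq hH hm (-μ)
    simp only [ofReal_neg, mul_neg, neg_smul, add_neg_cancel, norm_zero, norm_smul, norm_mul,
      norm_I, norm_real, one_mul, mul_pow, Real.norm_eq_abs, sq_abs] at h5
    have h6 : μ ^ 2 * ‖w‖ ^ 2 = 0 := by nlinarith
    simpa [hμ] using h6
  let e := ContinuousLinearEquiv.ofBijective L hker hrange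
  have he : ∀ v, L (e.symm v) = v := fun v => ContinuousLinearEquiv.ofBijective_apply_symm_apply ..
  refine ⟨(ContinuousLinearMap.fst ℂ X X).comp (H.graph.subtypeL.comp e.symm.toContinuousLinearMap),
    fun v => ?_, fun p hp => ?_, fun v => ?_⟩
  · have h1 := he v
    rw [hL] at h1
    have h2 : ((e.symm v : X × X).1, v - (I * μ) • (e.symm v : X × X).1) = (e.symm v : X × X) := by
      ext
      · rfl
      · exact sub_eq_of_eq_add h1.symm
    change ((e.symm v : X × X).1, v - (I * μ) • (e.symm v : X × X).1) ∈ H.graph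
    rw [h2]
    exact (e.symm v).2
  · change ((e.symm (L ⟨p, hp⟩) : X × X)).1 = p.1
    have : e.symm (L ⟨p, hp⟩) = ⟨p, hp⟩ := ContinuousLinearEquiv.ofBijective_symm_apply_apply ..
    rw [this]
  · have := hb1 (e.symm v)
    rwa [he] at this

/-- Bounded self-adjoint commuting approximants of `H`. -/
theorem exists_approx (hH : IsSelfAdjoint H) :
    ∃ B : ℕ → X →L[ℂ] X, (∀ n, IsSelfAdjoint (B n)) ∧ (∀ m n, Commute (B m) (B n)) ∧
      ∀ p ∈ H.graph, Tendsto (fun n => B n p.1) atTop (𝓝 p.2) := by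
  have hex : ∀ μ : ℝ, ∃ R : X →L[ℂ] X, μ ≠ 0 → (∀ v, (R v, v - (I * μ) • R v) ∈ H.graph) ∧
      (∀ p ∈ H.graph, R (p.2 + (I * μ) • p.1) = p.1) ∧ ∀ v, |μ| * ‖R v‖ ≤ ‖v‖ := fun μ => by
    by_cases h : μ = 0
    · exact ⟨0, fun h' => absurd h h'⟩
    · obtain ⟨R, hR⟩ := exists_resolvent hH h
      exact ⟨R, fun _ => hR⟩
  choose R hR using hex
  have hcomm : ∀ a b : ℝ, a ≠ 0 → b ≠ 0 → Commute (R a) (R b) := fun a b ha hb => by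
    rcases eq_or_ne a b with rfl | hab
    · exact Commute.refl _
    have key : ∀ a b : ℝ, a ≠ 0 → b ≠ 0 → ∀ x, R a x = R b x + (I * (b - a)) • R a (R b x) := by
      intro a b ha hb x
      have h1 := (hR a ha).2.1 _ ((hR b hb).1 x)
      have h2 : x - (I * b) • R b x + (I * a) • R b x = x - (I * (b - a)) • R b x := by module
      simp only [h2, map_sub, map_smul] at h1
      exact sub_eq_iff_eq_add.1 h1
    ext x
    have h1 := key a b ha hb x
    have h2 := key b a hb ha x
    have h3 : (I * (b - a) : ℂ) • (R a (R b x) - R b (R a x)) = 0 := by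
      linear_combination (norm := module) -h1 - h2
    have h5 : (I * (b - a) : ℂ) ≠ 0 :=
      mul_ne_zero I_ne_zero (sub_ne_zero.2 (by exact_mod_cast hab.symm))
    exact sub_eq_zero.1 ((smul_eq_zero.1 h3).resolve_left h5)
  have hadj : ∀ a : ℝ, a ≠ 0 → ∀ x y, inner ℂ (R a x) y = inner ℂ x (R (-a) y) := by
    intro a ha x y
    have h1 := graph_symm hH ((hR a ha).1 x) ((hR (-a) (neg_ne_zero.2 ha)).1 y)
    simp only [inner_sub_left, inner_sub_right, inner_smul_left, inner_smul_right, map_mul, conj_I,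
      conj_ofReal, ofReal_neg] at h1
    linear_combination -h1
  have hlim : ∀ σ : ℝ, (σ = 1 ∨ σ = -1) → ∀ y : X,
      Tendsto (fun n : ℕ => (I * (σ * (n + 1 : ℝ) : ℝ)) • R (σ * (n + 1)) y) atTop (𝓝 y) := by
    intro σ hσ y
    have habs : ∀ n : ℕ, |σ * (n + 1 : ℝ)| = n + 1 := fun n => by
      rcases hσ with rfl | rfl
      · rw [one_mul, abs_of_pos (by positivity)]
      · rw [neg_one_mul, abs_neg, abs_of_pos (by positivity)]
    have hne : ∀ n : ℕ, σ * (n + 1 : ℝ) ≠ 0 := fun n => abs_pos.1 (by rw [habs]; positivity)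
    have hle : ∀ (n : ℕ) (v : X), ‖(I * (σ * (n + 1 : ℝ) : ℝ)) • R (σ * (n + 1)) v‖ ≤ ‖v‖ :=
      fun n v => by
        rw [norm_smul, norm_mul, norm_I, norm_real, Real.norm_eq_abs, one_mul]
        exact (hR _ (hne n)).2.2 v
    rw [Metric.tendsto_atTop]
    intro ε hε
    obtain ⟨p, hp, hyp⟩ := graph_dense hH y (ε := ε / 3) (by positivity)
    obtain ⟨N, hN⟩ := exists_nat_gt (‖p.2‖ / (ε / 3))
    refine ⟨N, fun n hn => ?_⟩
    have h1 := (hR _ (hne n)).2.1 p hp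
    rw [map_add, map_smul] at h1
    have h2 : ‖R (σ * (n + 1)) p.2‖ < ε / 3 := by
      have h3 := (hR _ (hne n)).2.2 p.2
      rw [habs] at h3
      have h4 : ‖p.2‖ < ε / 3 * (n + 1) := by
        rw [div_lt_iff₀ (by positivity)] at hN
        have : (N : ℝ) ≤ n := by exact_mod_cast hn
        nlinarith
      have hn0 : (0 : ℝ) < n + 1 := by positivity
      by_contra hcon
      push Not at hcon
      nlinarith
    rw [dist_eq_norm]
    have h5 : (I * (σ * (n + 1 : ℝ) : ℝ)) • R (σ * (n + 1)) y - y =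
        (I * (σ * (n + 1 : ℝ) : ℝ)) • R (σ * (n + 1)) (y - p.1) - R (σ * (n + 1)) p.2 - (y - p.1) := by
      rw [map_sub]
      linear_combination (norm := module) h1
    rw [h5]
    have h6 := hle n (y - p.1)
    have h7 := norm_sub_le ((I * (σ * (n + 1 : ℝ) : ℝ)) • R (σ * (n + 1)) (y - p.1) -
      R (σ * (n + 1)) p.2) (y - p.1)
    have h8 := norm_sub_le ((I * (σ * (n + 1 : ℝ) : ℝ)) • R (σ * (n + 1)) (y - p.1))
      (R (σ * (n + 1)) p.2)
    linarith
  have hn0 : ∀ n : ℕ, (n + 1 : ℝ) ≠ 0 := fun n => by positivity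
  have hn0' : ∀ n : ℕ, (-(n + 1) : ℝ) ≠ 0 := fun n => neg_ne_zero.2 (hn0 n)
  refine ⟨fun n => (((n + 1 : ℝ) ^ 2 / 2 : ℝ) : ℂ) • (R (n + 1) + R (-(n + 1))),
    fun n => ?_, fun m n => ?_, fun p hp => ?_⟩
  · rw [ContinuousLinearMap.isSelfAdjoint_iff_isSymmetric]
    intro x y
    have h1 := hadj (n + 1) (hn0 n) x y
    have h2 := hadj (-(n + 1)) (hn0' n) x y
    rw [neg_neg] at h2
    simp only [ContinuousLinearMap.coe_coe, smul_apply,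
      add_apply, inner_smul_left, inner_smul_right, inner_add_left,
      inner_add_right, conj_ofReal, h1, h2]
    ring
  · refine Commute.smul_left (Commute.smul_right ?_ _) _
    exact ((hcomm _ _ (hn0 m) (hn0 n)).add_right (hcomm _ _ (hn0 m) (hn0' n))).add_left
      ((hcomm _ _ (hn0' m) (hn0 n)).add_right (hcomm _ _ (hn0' m) (hn0' n)))
  · have h1 := (hlim 1 (Or.inl rfl) p.2).add (hlim (-1) (Or.inr rfl) p.2)
    have h2 := h1.const_smul (1 / 2 : ℂ)
    have h3 : (1 / 2 : ℂ) • (p.2 + p.2) = p.2 := by module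
    rw [h3] at h2
    refine h2.congr fun n => ?_
    have h4 := (hR _ (hn0 n)).2.1 p hp
    have h5 := (hR _ (hn0' n)).2.1 p hp
    rw [map_add, map_smul] at h4 h5
    simp only [one_mul, neg_one_mul, smul_apply, add_apply]
    rw [eq_sub_of_add_eq h4, eq_sub_of_add_eq h5]
    match_scalars <;> ring_nf <;> simp <;> ring

/-- The group `e^{-itB}` of a bounded operator `B`. -/
noncomputable def boundedGroup (B : X →L[ℂ] X) (t : ℝ) : X →L[ℂ] X :=
  NormedSpace.exp (t • (-I • B))

theorem boundedGroup_zero (B : X →L[ℂ] X) : boundedGroup B 0 = 1 := by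
  simp [boundedGroup]

theorem boundedGroup_add (B : X →L[ℂ] X) (s t : ℝ) :
    boundedGroup B (s + t) = boundedGroup B s * boundedGroup B t := by
  let _ : NormedAlgebra ℚ (X →L[ℂ] X) := NormedAlgebra.restrictScalars ℚ ℂ _
  rw [boundedGroup, add_smul]
  exact NormedSpace.exp_add_of_commute (((Commute.refl _).smul_right _).smul_left _)

theorem boundedGroup_norm {B : X →L[ℂ] X} (hB : IsSelfAdjoint B) (t : ℝ) (x : X) :
    ‖boundedGroup B t x‖ = ‖x‖ := by
  let _ : NormedAlgebra ℚ (X →L[ℂ] X) := NormedAlgebra.restrictScalars ℚ ℂ _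
  have h1 : t • (-I • B) ∈ skewAdjoint (X →L[ℂ] X) :=
    skewAdjoint.smul_mem _ (hB.smul_mem_skewAdjoint (by simp [skewAdjoint.mem_iff]))
  have h2 : boundedGroup B t ∈ unitary (X →L[ℂ] X) :=
    NormedSpace.exp_mem_unitary_of_mem_skewAdjoint h1
  exact ContinuousLinearMap.norm_map_of_mem_unitary h2 x

theorem boundedGroup_hasDerivAt (B : X →L[ℂ] X) (x : X) (t : ℝ) :
    HasDerivAt (fun s : ℝ => boundedGroup B s x) (boundedGroup B t (-I • B x)) t := by
  have h := hasDerivAt_exp_smul_const (𝕂 := ℝ) (-I • B) t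
  have h2 := ((ContinuousLinearMap.apply ℂ X x).restrictScalars ℝ).hasFDerivAt.comp_hasDerivAt t h
  exact h2

theorem boundedGroup_sub_le {B : X →L[ℂ] X} (hB : IsSelfAdjoint B) (x : X) (t : ℝ) :
    ‖boundedGroup B t x - x‖ ≤ |t| * ‖B x‖ := by
  have h := (convex_univ (𝕜 := ℝ) (E := ℝ)).norm_image_sub_le_of_norm_hasDerivWithin_le
    (f := fun s : ℝ => boundedGroup B s x) (f' := fun s => boundedGroup B s (-I • B x))
    (C := ‖B x‖) (x := 0) (y := t)
    (fun s _ => (boundedGroup_hasDerivAt B x s).hasDerivWithinAt)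
    (fun s _ => by rw [boundedGroup_norm hB, norm_smul]; simp) trivial trivial
  simpa [boundedGroup_zero, mul_comm] using h

theorem boundedGroup_sub_le' {B C : X →L[ℂ] X} (hB : IsSelfAdjoint B) (hC : IsSelfAdjoint C)
    (hBC : Commute B C) (x : X) (t : ℝ) :
    ‖boundedGroup B t x - boundedGroup C t x‖ ≤ |t| * ‖B x - C x‖ := by
  let _ : NormedAlgebra ℚ (X →L[ℂ] X) := NormedAlgebra.restrictScalars ℚ ℂ _
  have h : boundedGroup B t = boundedGroup C t * boundedGroup (B - C) t := by
    rw [boundedGroup, boundedGroup, boundedGroup, ← NormedSpace.exp_add_of_commute]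
    · congr 1
      module
    · exact ((((hBC.symm.sub_right (Commute.refl C)).smul_right _).smul_left _).smul_right
        _).smul_left _
  have h1 := boundedGroup_sub_le (hB.sub hC) x t
  rw [h]
  change ‖boundedGroup C t (boundedGroup (B - C) t x) - boundedGroup C t x‖ ≤ _
  rw [← map_sub, boundedGroup_norm hC]
  exact h1

theorem boundedGroup_taylor {B : X →L[ℂ] X} (hB : IsSelfAdjoint B) (x y z : X) (t : ℝ) :
    ‖boundedGroup B t x - x - t • (-I • y)‖ ≤
      (‖B x - y‖ + 2 * ‖y - z‖ + |t| * ‖B z‖) * |t| := by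
  have h := (convex_uIcc (0 : ℝ) t).norm_image_sub_le_of_norm_hasDerivWithin_le
    (f := fun s : ℝ => boundedGroup B s x - s • (-I • y))
    (f' := fun s => boundedGroup B s (-I • B x) - (1 : ℝ) • (-I • y))
    (C := ‖B x - y‖ + 2 * ‖y - z‖ + |t| * ‖B z‖) (x := 0) (y := t)
    (fun s _ => ((boundedGroup_hasDerivAt B x s).sub
      ((hasDerivAt_id s).smul_const _)).hasDerivWithinAt)
    (fun s hs => ?_) Set.left_mem_uIcc Set.right_mem_uIcc
  · have e : boundedGroup B t x - x - t • (-I • y) =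
        boundedGroup B t x - t • (-I • y) - (boundedGroup B 0 x - (0 : ℝ) • (-I • y)) := by
      rw [boundedGroup_zero, zero_smul, sub_zero, one_apply_eq_self]
      abel
    rw [e]
    simpa using h
  · have hs' : |s| ≤ |t| := by
      simpa using Set.abs_sub_left_of_mem_uIcc hs
    have e : boundedGroup B s (-I • B x) - (1 : ℝ) • (-I • y) =
        -I • (boundedGroup B s (B x - y) + boundedGroup B s (y - z)
          + (boundedGroup B s z - z) + (z - y)) := by
      simp only [map_smul, map_sub, one_smul]
      module
    rw [e, norm_smul, norm_neg, norm_I, one_mul]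
    have h1 := boundedGroup_norm hB s (B x - y)
    have h2 := boundedGroup_norm hB s (y - z)
    have h3 := boundedGroup_sub_le hB z s
    have h4 := norm_sub_rev z y
    have h5 : |s| * ‖B z‖ ≤ |t| * ‖B z‖ := by gcongr
    have h6 := norm_add_le (boundedGroup B s (B x - y) + boundedGroup B s (y - z)
          + (boundedGroup B s z - z)) (z - y)
    have h7 := norm_add₃_le (a := boundedGroup B s (B x - y)) (b := boundedGroup B s (y - z))
          (c := boundedGroup B s z - z)
    linarith

/-- **Stone's theorem**, existence: a self-adjoint operator generates a unitary group. -/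
theorem exists_isUnitaryGroupOf (hH : IsSelfAdjoint H) :
    ∃ T : ℝ → X →L[ℂ] X, IsUnitaryGroupOf H T := by
  obtain ⟨B, hB, hcomm, hlim⟩ := exists_approx hH
  have hcau : ∀ t x, CauchySeq fun n => boundedGroup (B n) t x := by
    intro t x
    rw [Metric.cauchySeq_iff]
    intro ε hε
    obtain ⟨p, hp, hxp⟩ := graph_dense hH x (ε := ε / 3) (by positivity)
    obtain ⟨N, hN⟩ := Metric.cauchySeq_iff.1 (hlim p hp).cauchySeq (ε / 3 / (|t| + 1))
      (by positivity)
    refine ⟨N, fun m hm n hn => ?_⟩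
    have h1 := hN m hm n hn
    rw [dist_eq_norm, lt_div_iff₀ (by positivity)] at h1
    have h2 := boundedGroup_sub_le' (hB m) (hB n) (hcomm m n) p.1 t
    have h3 := boundedGroup_norm (hB m) t (x - p.1)
    have h4 := boundedGroup_norm (hB n) t (x - p.1)
    have e : boundedGroup (B m) t x - boundedGroup (B n) t x =
        boundedGroup (B m) t (x - p.1) + (boundedGroup (B m) t p.1 - boundedGroup (B n) t p.1)
          - boundedGroup (B n) t (x - p.1) := by
      simp only [map_sub]; abel
    rw [dist_eq_norm, e]
    have h5 := norm_sub_le (boundedGroup (B m) t (x - p.1) +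
      (boundedGroup (B m) t p.1 - boundedGroup (B n) t p.1)) (boundedGroup (B n) t (x - p.1))
    have h6 := norm_add_le (boundedGroup (B m) t (x - p.1))
      (boundedGroup (B m) t p.1 - boundedGroup (B n) t p.1)
    have h7 := norm_nonneg (B m p.1 - B n p.1)
    nlinarith
  choose f hf using fun t x => cauchySeq_tendsto_of_complete (hcau t x)
  have hnorm : ∀ t x, ‖f t x‖ = ‖x‖ := fun t x =>
    tendsto_nhds_unique (hf t x).norm
      (tendsto_const_nhds.congr fun n => (boundedGroup_norm (hB n) t x).symm)
  let T : ℝ → X →L[ℂ] X := fun t => LinearMap.mkContinuous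
    { toFun := f t
      map_add' := fun x y => tendsto_nhds_unique (hf t (x + y))
        (((hf t x).add (hf t y)).congr fun n => (map_add _ _ _).symm)
      map_smul' := fun c x => tendsto_nhds_unique (hf t (c • x))
        (((hf t x).const_smul c).congr fun n => (map_smul _ _ _).symm) } 1
    fun x => by simp [hnorm]
  have hT : ∀ t x, Tendsto (fun n => boundedGroup (B n) t x) atTop (𝓝 (T t x)) := hf
  have hTn : ∀ t x, ‖T t x‖ = ‖x‖ := hnorm
  have hT0 : T 0 = 1 := by
    ext x
    exact tendsto_nhds_unique (hT 0 x)
      (tendsto_const_nhds.congr fun n => by rw [boundedGroup_zero])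
  have hTadd : ∀ s t, T (s + t) = T s * T t := by
    intro s t
    ext x
    have h1 : Tendsto (fun n => boundedGroup (B n) s (boundedGroup (B n) t x - T t x)) atTop
        (𝓝 0) := by
      rw [tendsto_zero_iff_norm_tendsto_zero]
      have := (hT t x).sub_const (T t x)
      rw [sub_self, tendsto_zero_iff_norm_tendsto_zero] at this
      exact this.congr fun n => (boundedGroup_norm (hB n) s _).symm
    have h2 := h1.add (hT s (T t x))
    rw [zero_add] at h2
    refine tendsto_nhds_unique (hT (s + t) x) (h2.congr fun n => ?_)
    rw [boundedGroup_add, map_sub, sub_add_cancel]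
    rfl
  have hTinner : ∀ t x y, inner ℂ (T t x) (T t y) = inner ℂ x y := fun t x y =>
    (LinearMap.norm_map_iff_inner_map_map (T t)).1 (hTn t) x y
  have hinv : ∀ t x, T t (T (-t) x) = x := fun t x => by
    have := hTadd t (-t)
    rw [add_neg_cancel, hT0] at this
    exact (congrArg (fun S : X →L[ℂ] X => S x) this).symm
  have hinv' : ∀ t x, T (-t) (T t x) = x := fun t x => by
    have := hinv (-t) x
    rwa [neg_neg] at this
  have hTadj : ∀ t, star (T t) = T (-t) := fun t => by
    rw [ContinuousLinearMap.star_eq_adjoint]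
    refine ((ContinuousLinearMap.eq_adjoint_iff _ _).2 fun x y => ?_).symm
    rw [← hTinner t, hinv]
  have htaylor : ∀ p ∈ H.graph, ∀ q ∈ H.graph, ∀ t,
      ‖T t p.1 - p.1 - t • (-I • p.2)‖ ≤ (2 * ‖p.2 - q.1‖ + |t| * ‖q.2‖) * |t| := by
    intro p hp q hq t
    have h1 := (((hT t p.1).sub_const p.1).sub_const (t • (-I • p.2))).norm
    have h2 := ((((hlim p hp).sub_const p.2).norm.add_const (2 * ‖p.2 - q.1‖)).add
      ((hlim q hq).norm.const_mul |t|)).mul_const |t|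
    rw [sub_self, norm_zero, zero_add] at h2
    exact le_of_tendsto_of_tendsto' h1 h2 fun n => boundedGroup_taylor (hB n) _ _ _ _
  have hder : ∀ p ∈ H.graph, HasDerivAt (fun t : ℝ => T t p.1) (-I • p.2) 0 := by
    intro p hp
    rw [hasDerivAt_iff_isLittleO, Asymptotics.isLittleO_iff]
    intro ε hε
    obtain ⟨q, hq, hpq⟩ := graph_dense hH p.2 (ε := ε / 4) (by positivity)
    have hev : ∀ᶠ t : ℝ in 𝓝 0, |t| * ‖q.2‖ < ε / 2 := by
      have : Tendsto (fun t : ℝ => |t| * ‖q.2‖) (𝓝 0) (𝓝 (|0| * ‖q.2‖)) :=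
        (Continuous.tendsto (by fun_prop) 0)
      rw [abs_zero, zero_mul] at this
      exact this.eventually_lt_const (by positivity)
    filter_upwards [hev] with t ht
    have h1 := htaylor p hp q hq t
    rw [hT0, one_apply_eq_self, sub_zero, Real.norm_eq_abs]
    refine h1.trans ?_
    gcongr
    linarith
  refine ⟨T, hT0, hTadd, fun t => ?_, fun x => ?_, fun x y => ⟨fun h => hder _ h, fun h => ?_⟩⟩
  · rw [Unitary.mem_iff, hTadj]
    exact ⟨ContinuousLinearMap.ext fun x => hinv' t x, ContinuousLinearMap.ext fun x => hinv t x⟩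
  · have h0 : ContinuousAt (fun t => T t x) 0 := by
      rw [Metric.continuousAt_iff']
      intro ε hε
      obtain ⟨p, hp, hxp⟩ := graph_dense hH x (ε := ε / 3) (by positivity)
      have h1 := Metric.continuousAt_iff'.1 (hder p hp).continuousAt (ε / 3) (by positivity)
      filter_upwards [h1] with t ht
      rw [hT0, dist_eq_norm, one_apply_eq_self] at ht ⊢
      have e : T t x - x = T t (x - p.1) + (T t p.1 - p.1) + (p.1 - x) := by
        rw [map_sub]; abel
      rw [e]
      have h2 := norm_add₃_le (a := T t (x - p.1)) (b := T t p.1 - p.1) (c := p.1 - x)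
      rw [hTn, norm_sub_rev p.1 x] at h2
      linarith
    rw [continuous_iff_continuousAt]
    intro t
    have h1 : ContinuousAt (fun s => T t (T (s - t) x)) t := by
      refine (T t).continuous.continuousAt.comp
        (ContinuousAt.comp (g := fun s => T s x) ?_ (by fun_prop))
      rwa [sub_self]
    refine h1.congr (Eventually.of_forall fun s => ?_)
    change (T t * T (s - t)) x = T s x
    rw [← hTadd, add_sub_cancel]
  · refine graph_max hH fun p hp => ?_
    have h1 : HasDerivAt (fun t : ℝ => inner ℂ (T t x) p.1) (inner ℂ (-I • y) p.1) 0 := by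
      simpa using h.inner ℂ (hasDerivAt_const (0 : ℝ) p.1)
    have h2 : HasDerivAt (fun t : ℝ => T (-t) p.1) (I • p.2) 0 := by
      have h3 : HasDerivAt (fun t : ℝ => T t p.1) (-I • p.2) (-0) := by
        rw [neg_zero]; exact hder p hp
      simpa [Function.comp_def] using h3.scomp (0 : ℝ) (hasDerivAt_neg (0 : ℝ))
    have h4 : HasDerivAt (fun t : ℝ => inner ℂ x (T (-t) p.1)) (inner ℂ x (I • p.2)) 0 := by
      simpa only [inner_zero_left, add_zero] using (hasDerivAt_const (0 : ℝ) x).inner ℂ h2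
    have h5 : (fun t : ℝ => inner ℂ (T t x) p.1) = fun t => inner ℂ x (T (-t) p.1) := by
      funext t
      rw [← hTinner t x, hinv]
    rw [h5] at h1
    have h6 := h1.unique h4
    rw [inner_smul_left, inner_smul_right, map_neg, conj_I, neg_neg] at h6
    exact mul_left_cancel₀ I_ne_zero h6

/-- A self-adjoint operator generates only one unitary group. -/
theorem IsUnitaryGroupOf.unique (hH : IsSelfAdjoint H) {S T : ℝ → X →L[ℂ] X}
    (hS : IsUnitaryGroupOf H S) (hT : IsUnitaryGroupOf H T) : S = T := by
  have key : ∀ {T : ℝ → X →L[ℂ] X}, IsUnitaryGroupOf H T → ∀ p ∈ H.graph, ∀ t,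
      (T t p.1, T t p.2) ∈ H.graph ∧ HasDerivAt (fun s : ℝ => T s p.1) (-I • T t p.2) t := by
    intro T hT p hp t
    have h1 : HasDerivAt (fun s : ℝ => T t (T s p.1)) (T t (-I • p.2)) 0 :=
      ((T t).restrictScalars ℝ).hasFDerivAt.comp_hasDerivAt 0 ((hT.generator _ _).1 hp)
    rw [map_smul] at h1
    have h2 : ∀ s, T t (T s p.1) = T (t + s) p.1 := fun s => by rw [hT.add]; rfl
    constructor
    · rw [hT.generator]
      convert h1 using 2 with s
      rw [h2, add_comm, hT.add]; rfl
    · simp only [h2] at h1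
      have h3 : HasDerivAt (fun s : ℝ => T (t + s) p.1) (-I • T t p.2) (t - t) := by
        rwa [sub_self]
      simpa using h3.comp_sub_const t t
  funext t
  refine ContinuousLinearMap.ext fun x => ?_
  refine congrFun (Continuous.ext_on hH.dense_domain (S t).continuous (T t).continuous
    fun z hz => ?_) x
  have hp : (z, H ⟨z, hz⟩) ∈ H.graph := H.mem_graph ⟨z, hz⟩
  have hd : ∀ s : ℝ, HasDerivAt (fun s : ℝ => inner ℂ (S s z - T s z) (S s z - T s z)) 0 s := by
    intro s
    obtain ⟨g1, d1⟩ := key hS _ hp s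
    obtain ⟨g2, d2⟩ := key hT _ hp s
    have h1 := (d1.sub d2).inner ℂ (d1.sub d2)
    have h2 := graph_symm hH (H.graph.sub_mem g1 g2) (H.graph.sub_mem g1 g2)
    change inner ℂ (S s (H ⟨z, hz⟩) - T s (H ⟨z, hz⟩)) (S s z - T s z) =
      inner ℂ (S s z - T s z) (S s (H ⟨z, hz⟩) - T s (H ⟨z, hz⟩)) at h2
    have h3 : (0 : ℂ) =
      inner ℂ (S s z - T s z) (-I • S s (H ⟨z, hz⟩) - -I • T s (H ⟨z, hz⟩)) +
        inner ℂ (-I • S s (H ⟨z, hz⟩) - -I • T s (H ⟨z, hz⟩)) (S s z - T s z) := by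
      rw [← smul_sub, inner_smul_right, inner_smul_left, map_neg, conj_I, h2]
      ring
    rw [h3]
    exact h1
  have hc := is_const_of_deriv_eq_zero (fun s => (hd s).differentiableAt)
    (fun s => (hd s).deriv) t 0
  rw [hS.zero, hT.zero, sub_self, inner_zero_left, inner_self_eq_zero] at hc
  exact sub_eq_zero.1 hc

/-- The unitary group `t ↦ e^{-itH}` of a self-adjoint operator `H`. -/
noncomputable def unitaryGroup (H : X →ₗ.[ℂ] X) (hH : IsSelfAdjoint H) : ℝ → X →L[ℂ] X :=
  (exists_isUnitaryGroupOf hH).choose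

theorem unitaryGroup_spec (hH : IsSelfAdjoint H) : IsUnitaryGroupOf H (unitaryGroup H hH) :=
  (exists_isUnitaryGroupOf hH).choose_spec

end UnitaryEvolution

/-! The proof combines Baire's theorem with the closed graph theorem. Write `T t` for the group.
Since `A` is hermitean with dense domain, `‖A x‖ ≤ C` is equivalent to a family of conditions
continuous in `x` (`norm_apply_le_iff`). Strong continuity therefore makes each set `{t | ‖A (T t
ψ₀)‖ ≤ n}` closed, although `t ↦ A (T t ψ₀)` is not known to be continuous. These sets cover `ℝ`, so
one of them contains a ball around some `t₀`.

The bound is then carried to a ball of the same radius around any `c` by the fixed operator `T (c -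
t₀)`. Invariance is assumed only on `D(A) ∩ D(H)`, so `A T(c - t₀)` is considered there, with the
joint graph norm. That space is complete because both operators are closed, and the closed graph
theorem makes `A T(c - t₀)` bounded on it (`exists_bound_of_mapsTo`). Along the orbit, `‖T t ψ₀‖`
and `‖H (T t ψ₀)‖` are constant, since `T t` is unitary and commutes with `H` (`apply_mem_graph`),
so only the `A` part of the norm needs Baire's bound. A bounded set of times is covered by finitely
many such balls. -/

namespace UnitaryEvolution

/-- The group generated by `H` maps `D(H)` into itself and commutes with `H` there. -/
theorem IsUnitaryGroupOf.apply_mem_graph {X : Type*} [NormedAddCommGroup X]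
    [InnerProductSpace ℂ X] [CompleteSpace X] {H : X →ₗ.[ℂ] X} {T : ℝ → X →L[ℂ] X}
    (hT : IsUnitaryGroupOf H T) {x y : X} (h : (x, y) ∈ H.graph) (t : ℝ) :
    (T t x, T t y) ∈ H.graph := by
  -- The bounded operator `T t` passes through the derivative at `0`; as the group is abelian, the
  -- curve is also the orbit `s ↦ T s (T t x)`.
  have h1 : HasDerivAt (fun s : ℝ => T t (T s x)) (T t (-Complex.I • y)) 0 :=
    ((T t).restrictScalars ℝ).hasFDerivAt.comp_hasDerivAt 0 ((hT.generator _ _).1 h)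
  rw [map_smul] at h1
  rw [hT.generator]
  convert h1 using 2 with s
  change (T s * T t) x = (T t * T s) x
  rw [← hT.add, ← hT.add, add_comm]

/-- A hermitean densely defined operator has norm sublevel sets on its domain which are cut out by
the continuous conditions `‖⟪x, A η⟫‖ ≤ C ‖η‖`. -/
theorem norm_apply_le_iff {X : Type*} [NormedAddCommGroup X] [InnerProductSpace ℂ X]
    {A : X →ₗ.[ℂ] X} (hdense : Dense (A.domain : Set X)) (hherm : A.IsFormalAdjoint A)
    (x : A.domain) {C : ℝ} (hC : 0 ≤ C) :
    ‖A x‖ ≤ C ↔ ∀ η : A.domain, ‖inner ℂ (x : X) (A η)‖ ≤ C * ‖(η : X)‖ := by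
  constructor
  · intro h η
    rw [← hherm x η]
    exact (norm_inner_le_norm _ _).trans (by gcongr)
  · intro h
    -- For `z` in `D(A)` the estimate is the hypothesis with `A` moved across the inner product;
    -- both sides are continuous in `z`, so density extends it to all of `X`.
    have hall : ∀ z : X, ‖inner ℂ (A x) z‖ ≤ C * ‖z‖ := by
      intro z
      have hcl : IsClosed {z : X | ‖inner ℂ (A x) z‖ ≤ C * ‖z‖} :=
        isClosed_le (by fun_prop) (by fun_prop)
      refine hcl.closure_subset_iff.2 (fun η hη => ?_) (hdense z)
      change ‖inner ℂ (A x) η‖ ≤ C * ‖η‖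
      rw [hherm x ⟨η, hη⟩]
      exact h ⟨η, hη⟩
    -- The choice `z = A x` gives `‖A x‖ ^ 2 ≤ C * ‖A x‖`.
    have h1 := hall (A x)
    rw [inner_self_eq_norm_sq_to_K, norm_pow, RCLike.norm_ofReal, abs_norm, sq] at h1
    rcases (norm_nonneg (A x)).eq_or_lt with h0 | h0
    · rwa [← h0]
    · exact le_of_mul_le_mul_right h1 h0

/-- Closed graph theorem on `D(A) ∩ D(H)` with the joint graph norm. -/
theorem exists_bound_of_mapsTo {X : Type*} [NormedAddCommGroup X] [NormedSpace ℂ X]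
    [CompleteSpace X] {A H : X →ₗ.[ℂ] X} (hA : A.IsClosed) (hH : H.IsClosed) (S : X →L[ℂ] X)
    (hS : ∀ x ∈ A.domain ⊓ H.domain, S x ∈ A.domain) :
    ∃ C : ℝ, 0 ≤ C ∧ ∀ x a h b : X, (x, a) ∈ A.graph → (x, h) ∈ H.graph → (S x, b) ∈ A.graph →
      ‖b‖ ≤ C * max ‖x‖ (max ‖a‖ ‖h‖) := by
  let p : X × X × X →L[ℂ] X × X := (ContinuousLinearMap.fst ℂ X (X × X)).prod
    ((ContinuousLinearMap.fst ℂ X X).comp (ContinuousLinearMap.snd ℂ X (X × X)))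
  let q : X × X × X →L[ℂ] X × X := (ContinuousLinearMap.fst ℂ X (X × X)).prod
    ((ContinuousLinearMap.snd ℂ X X).comp (ContinuousLinearMap.snd ℂ X (X × X)))
  -- `Y` consists of the triples `(x, A x, H x)` with `x ∈ D(A) ∩ D(H)`; the product norm restricts
  -- to the joint graph norm.
  let Y : Submodule ℂ (X × X × X) :=
    A.graph.comap (p : X × X × X →ₗ[ℂ] X × X) ⊓ H.graph.comap (q : X × X × X →ₗ[ℂ] X × X)
  have hY : IsClosed (Y : Set (X × X × X)) :=
    (IsClosed.preimage p.continuous hA).inter (IsClosed.preimage q.continuous hH)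
  have : CompleteSpace Y := hY.completeSpace_coe
  have hmem : ∀ y : Y, S (y : X × X × X).1 ∈ A.domain := fun y =>
    hS _ ⟨LinearPMap.mem_domain_of_mem_graph (show ((y : X × X × X).1, _) ∈ A.graph from y.2.1),
      LinearPMap.mem_domain_of_mem_graph (show ((y : X × X × X).1, _) ∈ H.graph from y.2.2)⟩
  let Φ : Y →ₗ[ℂ] X := A.toFun ∘ₗ LinearMap.codRestrict A.domain
    ((S.comp (ContinuousLinearMap.fst ℂ X (X × X)) : X × X × X →ₗ[ℂ] X) ∘ₗ Y.subtype) hmem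
  have hΦ : ∀ y : Y, (S (y : X × X × X).1, Φ y) ∈ A.graph := fun y => A.mem_graph ⟨_, hmem y⟩
  have hcont : Continuous Φ := by
    -- Convergence in `Y` forces `S xₙ → S x`; if also `A (S xₙ) → z`, closedness of `A` gives `z =
    -- A (S x)`.
    refine Φ.continuous_of_seq_closed_graph fun u y z hu hz => ?_
    have h1 : Filter.Tendsto (fun n => S ((u n : X × X × X).1)) Filter.atTop
        (nhds (S (y : X × X × X).1)) :=
      ((S.continuous.comp (continuous_fst.comp continuous_subtype_val)).tendsto y).comp hu
    have h2 : (S (y : X × X × X).1, z) ∈ A.graph :=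
      IsClosed.mem_of_tendsto hA (h1.prodMk_nhds hz) (Filter.Eventually.of_forall fun n => hΦ (u n))
    exact A.mem_graph_snd_inj h2 (hΦ y) rfl
  let Ψ : Y →L[ℂ] X := ⟨Φ, hcont⟩
  refine ⟨‖Ψ‖, Ψ.opNorm_nonneg, fun x a h b hxa hxh hb => ?_⟩
  have h1 := Ψ.le_opNorm ⟨(x, a, h), hxa, hxh⟩
  rwa [show Ψ ⟨(x, a, h), hxa, hxh⟩ = b from
    A.mem_graph_snd_inj (hΦ ⟨(x, a, h), hxa, hxh⟩) hb rfl] at h1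

end UnitaryEvolution

/-- If `H` is self-adjoint, `A` is densely defined, hermitean and closed, and `e^{-itH}` leaves
`D(A) ∩ D(H)` invariant for all real `t`, then for `ψ₀ ∈ D(A) ∩ D(H)` the norm `‖A e^{-itH} ψ₀‖`
is bounded for `t` in any bounded set of times. -/
theorem proposition2 {X : Type*} [NormedAddCommGroup X] [InnerProductSpace ℂ X] [CompleteSpace X]
    (H A : X →ₗ.[ℂ] X) (hH : IsSelfAdjoint H)
    (hA_dense : Dense (A.domain : Set X)) (hA_herm : A.IsFormalAdjoint A) (hA_closed : A.IsClosed)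
    (hinv : ∀ t : ℝ, ∀ ψ ∈ A.domain ⊓ H.domain,
      UnitaryEvolution.unitaryGroup H hH t ψ ∈ A.domain ⊓ H.domain)
    (ψ₀ : X) (hψ₀ : ψ₀ ∈ A.domain ⊓ H.domain) (I : Set ℝ) (hI : Bornology.IsBounded I) :
    BddAbove ((fun t : ℝ =>
      ‖A ⟨UnitaryEvolution.unitaryGroup H hH t ψ₀, (hinv t ψ₀ hψ₀).1⟩‖) '' I) := by
  have hT := UnitaryEvolution.unitaryGroup_spec hH
  set T := UnitaryEvolution.unitaryGroup H hH
  have hmem : ∀ t, T t ψ₀ ∈ A.domain := fun t => (hinv t ψ₀ hψ₀).1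
  have hclosed : ∀ n : ℕ, IsClosed {t : ℝ | ‖A ⟨T t ψ₀, hmem t⟩‖ ≤ n} := by
    intro n
    have he : {t : ℝ | ‖A ⟨T t ψ₀, hmem t⟩‖ ≤ n} =
        ⋂ η : A.domain, {t : ℝ | ‖inner ℂ (T t ψ₀) (A η)‖ ≤ n * ‖(η : X)‖} := by
      ext t
      rw [Set.mem_iInter]
      exact UnitaryEvolution.norm_apply_le_iff hA_dense hA_herm ⟨T t ψ₀, hmem t⟩ n.cast_nonneg
    rw [he]
    refine isClosed_iInter fun η => isClosed_le ?_ continuous_const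
    exact ((hT.continuous ψ₀).inner continuous_const).norm
  -- Baire's theorem on `ℝ`: every `‖A (T t ψ₀)‖` is finite, so the closed sets exhaust the line.
  obtain ⟨n, t₀, ht₀⟩ := nonempty_interior_of_iUnion_of_closed hclosed
    (Set.iUnion_eq_univ_iff.2 fun t => exists_nat_ge ‖A ⟨T t ψ₀, hmem t⟩‖)
  obtain ⟨r, hr, hball⟩ := Metric.isOpen_iff.1 isOpen_interior t₀ ht₀
  -- The covering balls have exactly the radius `r` from Baire's theorem, so each is a translate of
  -- the good ball.
  obtain ⟨F, hF, hIF⟩ := Metric.totallyBounded_iff.1 (hI.isCompact_closure.totallyBounded.subset subset_closure) r hr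
  refine BddAbove.mono (Set.image_mono hIF) ?_
  rw [Set.image_iUnion₂, hF.bddAbove_biUnion]
  intro c _
  obtain ⟨C, hC, hbound⟩ := UnitaryEvolution.exists_bound_of_mapsTo hA_closed hH.isClosed
    (T (c - t₀)) fun x hx => (hinv (c - t₀) x hx).1
  -- The three entries bound the norms of `T u ψ₀`, `A (T u ψ₀)` and `H (T u ψ₀)` for every `u` in
  -- the ball around `t₀`; here `u = t - (c - t₀)`.
  refine ⟨C * max ‖ψ₀‖ (max n ‖H ⟨ψ₀, hψ₀.2⟩‖), ?_⟩
  rintro _ ⟨t, ht, rfl⟩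
  have hu : t - (c - t₀) ∈ Metric.ball t₀ r := by
    rw [Metric.mem_ball, Real.dist_eq] at ht ⊢
    convert ht using 2
    ring
  have hn : ‖A ⟨T (t - (c - t₀)) ψ₀, hmem _⟩‖ ≤ n :=
    (interior_subset (hball hu) : t - (c - t₀) ∈ {t : ℝ | ‖A ⟨T t ψ₀, hmem t⟩‖ ≤ n})
  have hcomp : T (c - t₀) (T (t - (c - t₀)) ψ₀) = T t ψ₀ := by
    change (T (c - t₀) * T (t - (c - t₀))) ψ₀ = T t ψ₀
    rw [← hT.add, add_sub_cancel]
  have hnorm : ∀ x, ‖T (t - (c - t₀)) x‖ = ‖x‖ :=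
    ContinuousLinearMap.norm_map_of_mem_unitary (hT.unitary _)
  have h1 := hbound _ _ _ (A ⟨T t ψ₀, hmem t⟩) (A.mem_graph ⟨T (t - (c - t₀)) ψ₀, hmem _⟩)
    (hT.apply_mem_graph (H.mem_graph ⟨ψ₀, hψ₀.2⟩) _)
    (by rw [hcomp]; exact A.mem_graph ⟨T t ψ₀, hmem t⟩)
  rw [hnorm, hnorm] at h1
  exact h1.trans (by gcongr)
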